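/- Let $\mathcal H$ be a separable complex Hilbert space, let $n\in\{2,3,\dots\}$ or $n=\infty$, and let $\{A_i\}_{i=1}^n$ be a family of bounded operators on $\mathcal H$ such that for every $X\in B(\mathcal H)$ the sum $$\varphi(X)=\sum_{i=1}^n A_iXA_i^*$$ exists in $B(\mathcal H)$, where for $n=\infty$ convergence is in the $w^*$-topology; thus $\varphi$ is a $w^*$-continuous completely positive linear map on $B(\mathcal H)$. Let $\mathcal O_n$ be the Cuntz algebra, i.e. the universal unital $C^*$-algebra generated by elements $v_1,\dots,v_n$ (a sequence $v_1,v_2,\dots$ if $n=\infty$) subject to the relations $v_i^*v_j=\delta_{ij}I$ and, if $n<\infty$, $\sum_{i=1}^n v_iv_i^*=I$. Let $\mathbb F_n^+$ be the free semigroup with generators $g_i$, $1\le i\le n$ (all $i\ge 1$ if $n=\infty$), and neutral element $g_0$. For $\alpha=g_{i_1}\cdots g_{i_k}$ put $A_\alpha=A_{i_1}\cdots A_{i_k}$, $v_\alpha=v_{i_1}\cdots v_{i_k}$, and put $A_{g_0}=I$, $v_{g_0}=I$. 1. If $D\in B(\mathcal H)$ is positive and invertible and $\varphi(D)=D$, then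 there is a unique completely positive linear map $\Phi_{\varphi,D}:\mathcal O_n\to B(\mathcal H)$ such that $\Phi_{\varphi,D}(I)=D$ and $$\Phi_{\varphi,D}(v_\alpha v_\beta^*)=A_\alpha DA_\beta^*\qquad\text{for all }\alpha,\beta\in\mathbb F_n^+.$$ 2. If $\varphi(I)=I$, then the same conclusion holds for every positive $D\in B(\mathcal H)$ with $\varphi(D)=D$, invertible or not. -/

import Mathlib

open scoped CStarAlgebra ENNReal InnerProductSpace

universe u

noncomputable section

/-- The Cuntz relations for a family `v` in a unital C⋆-algebra: `vᵢ⋆ vⱼ = δᵢⱼ 1`, and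
`∑ᵢ vᵢ vᵢ⋆ = 1` when the index set is finite.  (For an infinite index set the second relation is
omitted, as is standard for `𝒪_∞`.) -/
structure IsCuntzFamily {ι : Type} {B : Type*} [CStarAlgebra B] (v : ι → B) : Prop where
  star_mul_self (i : ι) : star (v i) * v i = 1
  star_mul_of_ne (i j : ι) (h : i ≠ j) : star (v i) * v j = 0
  sum_mul_star [Fintype ι] : ∑ i, v i * star (v i) = 1

/-- A model of the Cuntz relations: a nonzero unital C⋆-algebra with a Cuntz family in it. -/
structure CuntzModel (ι : Type) : Type (u + 1) where
  carrier : Type u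
  [cstar : CStarAlgebra carrier]
  [nontriv : Nontrivial carrier]
  v : ι → carrier
  isCuntz : IsCuntzFamily v

attribute [instance] CuntzModel.cstar CuntzModel.nontriv

/-- The C⋆-algebra of bounded families `(b_r)`, one `b_r` in each model `r` of the Cuntz relations,
with the supremum norm. -/
abbrev CuntzProduct (ι : Type) : Type (u + 1) :=
  lp (fun r : CuntzModel.{u} ι => r.carrier) ∞

instance CuntzProduct.instCStarAlgebra (ι : Type) : CStarAlgebra (CuntzProduct.{u} ι) where

theorem CuntzModel.norm_v_le {ι : Type} (r : CuntzModel.{u} ι) (i : ι) : ‖r.v i‖ ≤ 1 := by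
  have h := CStarRing.norm_star_mul_self (x := r.v i)
  rw [r.isCuntz.star_mul_self, CStarRing.norm_one] at h
  nlinarith [norm_nonneg (r.v i)]

/-- The family of all `i`-th generators of all models. -/
def CuntzProduct.v {ι : Type} (i : ι) : CuntzProduct.{u} ι :=
  ⟨fun r => r.v i, memℓp_infty ⟨1, by rintro _ ⟨r, rfl⟩; exact r.norm_v_le i⟩⟩

/-- The unital C⋆-algebra generated by the `CuntzProduct.v i`. -/
def cuntzSubalgebra (ι : Type) : StarSubalgebra ℂ (CuntzProduct.{u} ι) :=
  (StarAlgebra.adjoin ℂ (Set.range (CuntzProduct.v.{u} (ι := ι)))).topologicalClosure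

/-- The Cuntz algebra `𝒪_n`, with `n` the cardinality of `ι`: the universal unital C⋆-algebra
generated by a Cuntz family, that is, the closed unital ⋆-algebra generated by the canonical family
in the product of all models of the relations.  Its universal property is proved in
`CuntzAlgebra.existsUnique_lift`. -/
def CuntzAlgebra (ι : Type) : Type (u + 1) := cuntzSubalgebra.{u} ι

namespace CuntzAlgebra

instance instIsClosed (ι : Type) : IsClosed (cuntzSubalgebra.{u} ι : Set (CuntzProduct.{u} ι)) :=
  StarSubalgebra.isClosed_topologicalClosure _

instance instCStarAlgebra (ι : Type) : CStarAlgebra (CuntzAlgebra.{u} ι) :=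
  inferInstanceAs (CStarAlgebra (cuntzSubalgebra.{u} ι))

/-- The usual order of a C⋆-algebra. -/
instance instPartialOrder (ι : Type) : PartialOrder (CuntzAlgebra.{u} ι) :=
  CStarAlgebra.spectralOrder _

instance instStarOrderedRing (ι : Type) : StarOrderedRing (CuntzAlgebra.{u} ι) :=
  CStarAlgebra.spectralOrderedRing _

/-- The canonical generators `vᵢ` of the Cuntz algebra. -/
def v {ι : Type} (i : ι) : CuntzAlgebra.{u} ι :=
  ⟨CuntzProduct.v i, StarSubalgebra.le_topologicalClosure _
    (StarAlgebra.subset_adjoin ℂ _ (Set.mem_range_self i))⟩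

/-- The component of an element of the Cuntz algebra in a given model, as a unital
⋆-homomorphism. -/
def eval {ι : Type} (r : CuntzModel.{u} ι) : CuntzAlgebra.{u} ι →⋆ₐ[ℂ] r.carrier where
  toFun x := (x : cuntzSubalgebra.{u} ι).1 r
  map_one' := rfl
  map_mul' _ _ := rfl
  map_zero' := rfl
  map_add' _ _ := rfl
  commutes' _ := rfl
  map_star' _ := rfl

theorem ext_eval {ι : Type} {x y : CuntzAlgebra.{u} ι} (h : ∀ r, eval r x = eval r y) :
    x = y :=
  Subtype.ext (lp.ext (funext h))

theorem isCuntzFamily_v (ι : Type) : IsCuntzFamily (v.{u} (ι := ι)) where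
  star_mul_self i := ext_eval fun r => by
    rw [map_mul, map_star, map_one]; exact r.isCuntz.star_mul_self i
  star_mul_of_ne i j h := ext_eval fun r => by
    rw [map_mul, map_star, map_zero]; exact r.isCuntz.star_mul_of_ne i j h
  sum_mul_star := ext_eval fun r => by
    simp only [map_sum, map_mul, map_star, map_one]; exact r.isCuntz.sum_mul_star

/-- The generators generate: the unital ⋆-algebra that they generate is dense. -/
theorem topologicalClosure_adjoin_v (ι : Type) :
    (StarAlgebra.adjoin ℂ (Set.range (v.{u} (ι := ι)))).topologicalClosure = ⊤ := by
  let j : CuntzAlgebra.{u} ι →⋆ₐ[ℂ] CuntzProduct.{u} ι := (cuntzSubalgebra.{u} ι).subtype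
  have hj : StarAlgebra.adjoin ℂ (Set.range (CuntzProduct.v.{u} (ι := ι))) =
      (StarAlgebra.adjoin ℂ (Set.range (v.{u} (ι := ι)))).map j := by
    rw [StarAlgHom.map_adjoin, ← Set.range_comp]
    rfl
  refine eq_top_iff.2 fun x _ => ?_
  have hx : j x ∈
      (StarAlgebra.adjoin ℂ (Set.range (CuntzProduct.v.{u} (ι := ι)))).topologicalClosure :=
    Subtype.property (p := fun y => y ∈ cuntzSubalgebra.{u} ι) x
  rw [hj, ← SetLike.mem_coe, StarSubalgebra.topologicalClosure_coe, StarSubalgebra.coe_map] at hx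
  rw [← SetLike.mem_coe, StarSubalgebra.topologicalClosure_coe]
  have hind : Topology.IsInducing j := ⟨rfl⟩
  rw [hind.closure_eq_preimage_closure_image]
  exact hx

/-- The universal property of the Cuntz algebra. -/
theorem existsUnique_lift {ι : Type} {B : Type u} [CStarAlgebra B] (w : ι → B)
    (hw : IsCuntzFamily w) :
    ∃! f : CuntzAlgebra.{u} ι →⋆ₐ[ℂ] B, ∀ i, f (v i) = w i := by
  refine existsUnique_of_exists_of_unique ?_ fun f g hf hg => ?_
  · rcases subsingleton_or_nontrivial B with hB | hB
    · exact ⟨{ toFun := fun _ => 0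
               map_one' := Subsingleton.elim _ _
               map_mul' := fun _ _ => Subsingleton.elim _ _
               map_zero' := rfl
               map_add' := fun _ _ => Subsingleton.elim _ _
               commutes' := fun _ => Subsingleton.elim _ _
               map_star' := fun _ => Subsingleton.elim _ _ }, fun _ => Subsingleton.elim _ _⟩
    · exact ⟨eval { carrier := B, v := w, isCuntz := hw }, fun _ => rfl⟩
  · have hc : IsClosed (StarAlgHom.equalizer f g : Set (CuntzAlgebra.{u} ι)) :=
      isClosed_eq (map_continuous f) (map_continuous g)
    have hle := StarSubalgebra.topologicalClosure_minimal (StarAlgHom.adjoin_le_equalizer f g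
      (s := Set.range v) (by rintro _ ⟨i, rfl⟩; exact (hf i).trans (hg i).symm)) hc
    rw [topologicalClosure_adjoin_v] at hle
    exact DFunLike.ext f g fun x => hle (StarSubalgebra.mem_top (R := ℂ) (x := x))

end CuntzAlgebra

/-- Convergence of the series `∑ᵢ fᵢ` to `s` in the w⋆-topology (the ultraweak topology) of the
bounded operators on `H`, that is, the topology given by the functionals `X ↦ ∑ₖ ⟪yₖ, X xₖ⟫` with
`(xₖ)`, `(yₖ)` square summable sequences of vectors. -/
def HasUltraweakSum {ι H : Type*} [NormedAddCommGroup H] [InnerProductSpace ℂ H]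
    (f : ι → H →L[ℂ] H) (s : H →L[ℂ] H) : Prop :=
  ∀ x y : lp (fun _ : ℕ => H) 2,
    HasSum (fun i => ∑' k, ⟪y k, f i (x k)⟫_ℂ) (∑' k, ⟪y k, s (x k)⟫_ℂ)

/-- The product `T_α = T_{i₁} ⋯ T_{iₖ}` along a word `α = g_{i₁} ⋯ g_{iₖ}` of the free semigroup
on `ι`; the empty word gives `1`. -/
def wordProd {ι M : Type*} [Monoid M] (T : ι → M) (α : FreeMonoid ι) : M := FreeMonoid.lift T α

end

open scoped CStarAlgebra ENNReal InnerProductSpace ComplexOrder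

/-! For invertible `D`, the operators `Bᵢ = D^{-1/2} Aᵢ D^{1/2}` satisfy `∑ Bᵢ Bᵢ⋆ = 1`. Such a row
dilates to a Cuntz family `V` on a larger space with `Vᵢ⋆ J = J Bᵢ⋆`
(`exists_isCuntzFamily_dilation`). Then `C = J D^{1/2}` intertwines `Vᵢ⋆` with `Aᵢ⋆` and `C⋆ C = D`,
so `x ↦ C⋆ π(x) C` is the required map, where `π` represents the Cuntz algebra by `V`.

The dilation rests on a dimension count: a unitary `U : K → ℓ²(ι, K)` yields a Cuntz family whose
adjoints are the coordinates of `U`, so it suffices that `U` extend the column `J h ↦ (J Bᵢ⋆ h)ᵢ`.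
It exists because both orthogonal complements are separable and infinite-dimensional.

If `φ(1) = 1`, then `D + ε` is an invertible fixed point for each `ε > 0`. The corresponding maps
are affine in `ε`, and complete positivity survives `ε → 0`. Uniqueness holds because the `v_α v_β⋆`
span a dense subspace. -/

/-! ### Separable Hilbert spaces and extension of isometries to unitaries -/

theorem Orthonormal.countable_of_separableSpace {E κ : Type*} [NormedAddCommGroup E]
    [InnerProductSpace ℂ E] [TopologicalSpace.SeparableSpace E] {e : κ → E}
    (he : Orthonormal ℂ e) : Countable κ := by
  -- Distinct orthonormal vectors are at distance √2 > 1, so these balls are disjoint.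
  refine Pairwise.countable_of_isOpen_disjoint (s := fun k => Metric.ball (e k) (1 / 2))
    (fun i j hij => Metric.ball_disjoint_ball ?_) (fun _ => Metric.isOpen_ball)
    (fun k => ⟨e k, Metric.mem_ball_self (by norm_num)⟩)
  have h : ‖e i - e j‖ ^ 2 = 2 := by
    rw [@norm_sub_sq ℂ, he.1, he.1, he.2 hij]
    norm_num
  rw [dist_eq_norm]
  nlinarith [norm_nonneg (e i - e j)]

/-- The sequence `e` serves only to force infinite dimension; separability makes every Hilbert basis
countable. -/
theorem Orthonormal.nonempty_hilbertBasis_nat {E : Type*} [NormedAddCommGroup E]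
    [InnerProductSpace ℂ E] [CompleteSpace E] [TopologicalSpace.SeparableSpace E] {e : ℕ → E}
    (he : Orthonormal ℂ e) : Nonempty (HilbertBasis ℕ ℂ E) := by
  obtain ⟨w, b, -⟩ := exists_hilbertBasis ℂ E
  have hc : Countable w := b.orthonormal.countable_of_separableSpace
  have hi : Infinite w := by
    by_contra hfin
    rw [not_infinite_iff_finite] at hfin
    have := Fintype.ofFinite w
    have : FiniteDimensional ℂ E := b.toOrthonormalBasis.toBasis.finiteDimensional_of_finite
    exact not_finite_iff_infinite.2 inferInstance (he.linearIndependent.finite)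
  obtain ⟨f⟩ := nonempty_equiv_of_countable (α := ℕ) (β := w)
  exact ⟨HilbertBasis.mk (b.orthonormal.comp f f.injective) (by
    rw [f.surjective.range_comp, b.dense_span])⟩

theorem lp.separableSpace_two {ι K : Type*} [Countable ι] [NormedAddCommGroup K]
    [InnerProductSpace ℂ K] [TopologicalSpace.SeparableSpace K] :
    TopologicalSpace.SeparableSpace (lp (fun _ : ι => K) 2) := by
  classical
  let S : Set (lp (fun _ : ι => K) 2) := ⋃ i, Set.range (lp.single 2 i)
  have hS : TopologicalSpace.IsSeparable S := .iUnion fun i =>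
    TopologicalSpace.isSeparable_range (lp.isometry_single i).continuous
  rw [← TopologicalSpace.isSeparable_univ_iff]
  refine (hS.span (R := ℂ)).closure.mono fun f _ => ?_
  refine mem_closure_of_tendsto (lp.hasSum_single (by norm_num) f) (.of_forall fun s => ?_)
  exact Submodule.sum_mem _ fun i _ => Submodule.subset_span (Set.mem_iUnion.2 ⟨i, _, rfl⟩)

/-- The orthogonal sum of two unitaries. -/
noncomputable def LinearIsometryEquiv.withLpProd {E E' F F' : Type*}
    [NormedAddCommGroup E] [InnerProductSpace ℂ E] [NormedAddCommGroup E'] [InnerProductSpace ℂ E']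
    [NormedAddCommGroup F] [InnerProductSpace ℂ F] [NormedAddCommGroup F'] [InnerProductSpace ℂ F']
    (e : E ≃ₗᵢ[ℂ] E') (f : F ≃ₗᵢ[ℂ] F') : WithLp 2 (E × F) ≃ₗᵢ[ℂ] WithLp 2 (E' × F') where
  toLinearEquiv := WithLp.linearEquiv 2 ℂ (E × F) ≪≫ₗ
    e.toLinearEquiv.prodCongr f.toLinearEquiv ≪≫ₗ (WithLp.linearEquiv 2 ℂ (E' × F')).symm
  norm_map' x := by
    rw [← sq_eq_sq₀ (norm_nonneg _) (norm_nonneg _), WithLp.prod_norm_sq_eq_of_L2,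
      WithLp.prod_norm_sq_eq_of_L2]
    exact congrArg₂ (fun a b : ℝ => a ^ 2 + b ^ 2) (e.norm_map x.fst) (f.norm_map x.snd)

/-- A Hilbert space embedded in a separable one with an infinite-dimensional co-range is in standard
position, up to a unitary. -/
theorem LinearIsometry.exists_linearIsometryEquiv_withLp {H G : Type*}
    [NormedAddCommGroup H] [InnerProductSpace ℂ H] [CompleteSpace H]
    [NormedAddCommGroup G] [InnerProductSpace ℂ G] [CompleteSpace G]
    [TopologicalSpace.SeparableSpace G] (k : H →ₗᵢ[ℂ] G) {d : ℕ → G} (hd : Orthonormal ℂ d)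
    (hk : ∀ n h, ⟪k h, d n⟫_ℂ = 0) :
    ∃ W : G ≃ₗᵢ[ℂ] WithLp 2 (H × lp (fun _ : ℕ => ℂ) 2),
      ∀ h, W (k h) = WithLp.toLp 2 (h, 0) := by
  let M : Submodule ℂ G := LinearMap.range k.toLinearMap
  have hM : IsComplete (M : Set G) := by
    have := k.isometry.isUniformInducing.isComplete_range
    exact this
  have : CompleteSpace M := hM.completeSpace_coe
  have hmem : ∀ n, d n ∈ Mᗮ := fun n => by
    rw [Submodule.mem_orthogonal]
    rintro _ ⟨h, rfl⟩
    exact hk n h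
  have hd' : Orthonormal ℂ (fun n => (⟨d n, hmem n⟩ : Mᗮ)) :=
    ⟨fun n => hd.1 n, fun _ _ hij => hd.2 hij⟩
  obtain ⟨b⟩ := hd'.nonempty_hilbertBasis_nat
  refine ⟨M.orthogonalDecomposition.trans
    (LinearIsometryEquiv.withLpProd k.equivRange.symm b.repr), fun h => ?_⟩
  have h1 : M.orthogonalProjectionOnto (k h) = k.equivRange h := by
    exact M.orthogonalProjectionOnto_mem_subspace_eq_self (k.equivRange h)
  have h2 : Mᗮ.orthogonalProjectionOnto (k h) = 0 := by
    exact Submodule.orthogonalProjectionOnto_orthogonal_apply_eq_zero ⟨h, rfl⟩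
  rw [LinearIsometryEquiv.trans_apply, Submodule.orthogonalDecomposition_apply, h1, h2]
  change WithLp.toLp 2 (k.equivRange.symm (k.equivRange h), b.repr 0) = _
  rw [LinearIsometryEquiv.symm_apply_apply, map_zero]

/-- Two isometries of a Hilbert space into separable Hilbert spaces, with infinite-dimensional
co-ranges, differ by a unitary. -/
theorem LinearIsometry.exists_linearIsometryEquiv_comp_eq {H E F : Type*}
    [NormedAddCommGroup H] [InnerProductSpace ℂ H] [CompleteSpace H]
    [NormedAddCommGroup E] [InnerProductSpace ℂ E] [CompleteSpace E]
    [TopologicalSpace.SeparableSpace E]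
    [NormedAddCommGroup F] [InnerProductSpace ℂ F] [CompleteSpace F]
    [TopologicalSpace.SeparableSpace F]
    (f : H →ₗᵢ[ℂ] E) (g : H →ₗᵢ[ℂ] F) {e : ℕ → E} {e' : ℕ → F}
    (he : Orthonormal ℂ e) (he' : Orthonormal ℂ e')
    (hf : ∀ n h, ⟪f h, e n⟫_ℂ = 0) (hg : ∀ n h, ⟪g h, e' n⟫_ℂ = 0) :
    ∃ U : E ≃ₗᵢ[ℂ] F, ∀ h, U (f h) = g h := by
  obtain ⟨W, hW⟩ := f.exists_linearIsometryEquiv_withLp he hf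
  obtain ⟨W', hW'⟩ := g.exists_linearIsometryEquiv_withLp he' hg
  exact ⟨W.trans W'.symm, fun h => by simp [hW, ← hW' h]⟩

/-! ### Cuntz families from unitaries, and the dilation -/

section Column

variable {ι H K : Type*} [NormedAddCommGroup H] [InnerProductSpace ℂ H]
  [NormedAddCommGroup K] [InnerProductSpace ℂ K]

/-- The column isometry `h ↦ (Tᵢ h)ᵢ` of a family of operators with `∑ᵢ ‖Tᵢ h‖² = ‖h‖²`. -/
noncomputable def columnIsometry (T : ι → H →L[ℂ] K)
    (hT : ∀ h, HasSum (fun i => ‖T i h‖ ^ 2) (‖h‖ ^ 2)) : H →ₗᵢ[ℂ] lp (fun _ : ι => K) 2 where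
  toFun h := ⟨fun i => T i h, memℓp_gen (by simpa using (hT h).summable)⟩
  map_add' _ _ := lp.ext (funext fun i => map_add (T i) _ _)
  map_smul' _ _ := lp.ext (funext fun i => map_smul (T i) _ _)
  norm_map' h := by
    have h2 := lp.hasSum_norm (p := 2) (by norm_num)
      (⟨fun i => T i h, memℓp_gen (by simpa using (hT h).summable)⟩ : lp (fun _ : ι => K) 2)
    simp only [ENNReal.toReal_ofNat, Real.rpow_ofNat] at h2
    exact (sq_eq_sq₀ (norm_nonneg _) (norm_nonneg _)).1 (h2.unique (hT h))

theorem lp.orthonormal_single [DecidableEq ι] {κ : Type*} {f : κ → ι} (hf : f.Injective) {x : K}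
    (hx : ‖x‖ = 1) : Orthonormal ℂ fun n => lp.single (E := fun _ : ι => K) 2 (f n) x :=
  ⟨fun n => by rw [lp.norm_single (by norm_num), hx], fun m n hmn => by
    dsimp only
    rw [lp.inner_single_left, lp.single_apply_ne _ _ _ (hf.ne hmn), inner_zero_right]⟩

theorem Orthonormal.lp_single [DecidableEq ι] {κ : Type*} {e : κ → K} (he : Orthonormal ℂ e)
    (i : ι) : Orthonormal ℂ fun n => lp.single (E := fun _ : ι => K) 2 i (e n) :=
  ⟨fun n => by rw [lp.norm_single (by norm_num), he.1], fun m n hmn => by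
    dsimp only
    rw [lp.inner_single_left, lp.single_apply_self, he.2 hmn]⟩

/-- The components of a unitary `lp (fun _ : ι => K) 2 ≃ K`. -/
noncomputable def rowComponent [DecidableEq ι] (U : K ≃ₗᵢ[ℂ] lp (fun _ : ι => K) 2) (i : ι) :
    K →L[ℂ] K :=
  (U.symm.toContinuousLinearEquiv : _ →L[ℂ] K) ∘L
    lp.singleContinuousLinearMap ℂ (fun _ : ι => K) 2 i

theorem rowComponent_apply [DecidableEq ι] (U : K ≃ₗᵢ[ℂ] lp (fun _ : ι => K) 2) (i : ι) (y : K) :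
    rowComponent U i y = U.symm (lp.single 2 i y) := rfl

variable [CompleteSpace K]

/-- Adjoints of the components read off the coordinates of `U`, which turns the Cuntz relations into
coordinate identities in ℓ². -/
theorem star_rowComponent_apply [DecidableEq ι] (U : K ≃ₗᵢ[ℂ] lp (fun _ : ι => K) 2) (i : ι)
    (x : K) : star (rowComponent U i) x = U x i := by
  refine ext_inner_right ℂ fun y => ?_
  rw [ContinuousLinearMap.star_eq_adjoint, ContinuousLinearMap.adjoint_inner_left,
    rowComponent_apply, ← U.inner_map_map, U.apply_symm_apply, lp.inner_single_right]

theorem isCuntzFamily_rowComponent {ι : Type} [DecidableEq ι]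
    (U : K ≃ₗᵢ[ℂ] lp (fun _ : ι => K) 2) : IsCuntzFamily (rowComponent U) where
  star_mul_self i := by
    ext x
    rw [mul_apply_eq_comp, star_rowComponent_apply, rowComponent_apply,
      U.apply_symm_apply, lp.single_apply_self, one_apply_eq_self]
  star_mul_of_ne i j hij := by
    ext x
    rw [mul_apply_eq_comp, star_rowComponent_apply, rowComponent_apply,
      U.apply_symm_apply, lp.single_apply_ne _ _ _ hij, zero_apply]
  sum_mul_star := by
    intro _
    ext x
    have h := (lp.hasSum_single (E := fun _ : ι => K) (p := 2) (by norm_num) (U x)).unique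
      (hasSum_fintype _)
    simp only [sum_apply, mul_apply_eq_comp,
      star_rowComponent_apply, rowComponent_apply, one_apply_eq_self]
    rw [← map_sum, ← h, U.symm_apply_apply]

end Column

/-- Isometric dilation of a row co-isometry to a Cuntz family. -/
theorem exists_isCuntzFamily_dilation {ι : Type} [Countable ι] [Nonempty ι]
    {H : Type u} [NormedAddCommGroup H] [InnerProductSpace ℂ H] [CompleteSpace H]
    [TopologicalSpace.SeparableSpace H] (A : ι → H →L[ℂ] H)
    (hA : ∀ h, HasSum (fun i => ‖star (A i) h‖ ^ 2) (‖h‖ ^ 2)) :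
    ∃ (K : Type u) (_ : NormedAddCommGroup K) (_ : InnerProductSpace ℂ K) (_ : CompleteSpace K)
      (J : H →ₗᵢ[ℂ] K) (V : ι → K →L[ℂ] K), IsCuntzFamily V ∧
        ∀ i h, star (V i) (J h) = J (star (A i) h) := by
  classical
  -- The zero space has no unit vector to build the complement from, but there every relation is
  -- trivial.
  rcases subsingleton_or_nontrivial H with hH | hH
  · exact ⟨H, _, _, inferInstance, LinearIsometry.id, 0,
      ⟨fun _ => Subsingleton.elim _ _, fun _ _ _ => Subsingleton.elim _ _, Subsingleton.elim _ _⟩,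
      fun _ _ => Subsingleton.elim _ _⟩
  obtain ⟨x, hx⟩ := exists_norm_eq H zero_le_one
  let K := lp (fun _ : ℕ => H) 2
  have : TopologicalSpace.SeparableSpace K := lp.separableSpace_two
  have : TopologicalSpace.SeparableSpace (lp (fun _ : ι => K) 2) := lp.separableSpace_two
  let J : H →ₗᵢ[ℂ] K :=
    { toLinearMap := lp.lsingle (E := fun _ : ℕ => H) 2 0
      norm_map' := fun h => lp.norm_single (E := fun _ : ℕ => H) (by norm_num) 0 h }
  have hJ : ∀ h, J h = lp.single (E := fun _ : ℕ => H) 2 0 h := fun h => rfl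
  let g : H →ₗᵢ[ℂ] lp (fun _ : ι => K) 2 :=
    columnIsometry (fun i => J.toContinuousLinearMap ∘L star (A i))
      (fun h => by
        have hn : ∀ i, ‖(J.toContinuousLinearMap ∘L star (A i)) h‖ = ‖star (A i) h‖ :=
          fun i => J.norm_map _
        simpa only [hn] using hA h)
  -- The shift by one avoids coordinate 0, which holds the range of `J`.
  let e : ℕ → K := fun n => lp.single 2 (n + 1) x
  have he : Orthonormal ℂ e := lp.orthonormal_single (add_left_injective 1) hx
  have hJe : ∀ n h, ⟪J h, e n⟫_ℂ = 0 := fun n h => by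
    rw [hJ, lp.inner_single_left, lp.single_apply_ne _ _ _ (by simp), inner_zero_right]
  let i₀ : ι := Classical.arbitrary ι
  -- The copy of `e` in slot `i₀` is orthogonal to the range of `g`, whose entries all lie in the
  -- range of `J`. Read coordinatewise, `U J = g` is the required relation.
  obtain ⟨U, hU⟩ := J.exists_linearIsometryEquiv_comp_eq g he (he.lp_single i₀) hJe
    (fun n h => by
      rw [lp.inner_single_right]
      exact hJe n (star (A i₀) h))
  refine ⟨K, _, _, inferInstance, J, _, isCuntzFamily_rowComponent U, fun i h => ?_⟩
  rw [star_rowComponent_apply, hU]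
  rfl

/-! ### Positive operator matrices and compressions -/

section CompletelyPositive

open ContinuousLinearMap

variable {k H K : Type*} [Fintype k]
  [NormedAddCommGroup H] [InnerProductSpace ℂ H] [CompleteSpace H]
  [NormedAddCommGroup K] [InnerProductSpace ℂ K] [CompleteSpace K]

theorem exists_eq_star_mul_self_of_nonneg {B : Type*} [NonUnitalCStarAlgebra B] [PartialOrder B]
    [StarOrderedRing B] {a : B} (ha : 0 ≤ a) : ∃ y, a = star y * y :=
  CStarAlgebra.nonneg_iff_eq_star_mul_self.1 ha

/-- A selfadjoint element `a` of a C⋆-algebra has a conjugate `n⋆ a n ≤ 0`, whose vanishing implies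
`0 ≤ a`. -/
theorem IsSelfAdjoint.exists_star_conj_eq_neg {B : Type*} [NonUnitalCStarAlgebra B]
    [PartialOrder B] [StarOrderedRing B] {a : B} (ha : IsSelfAdjoint a) :
    ∃ n z : B, star n * a * n = -(star z * z) ∧ (z = 0 → 0 ≤ a) := by
  have hN : IsSelfAdjoint a⁻ := (CFC.negPart_nonneg a).isSelfAdjoint
  obtain ⟨z, hz⟩ := exists_eq_star_mul_self_of_nonneg
    (star_left_conjugate_nonneg (CFC.negPart_nonneg a) a⁻)
  refine ⟨a⁻, z, ?_, fun h => ?_⟩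
  -- Here `n = a⁻`, and both sides equal `-(a⁻)³`.
  · rw [← hz, hN.star_eq]
    nth_rw 2 [← CFC.posPart_sub_negPart a ha]
    rw [mul_sub, CFC.negPart_mul_posPart, zero_sub, neg_mul]
  -- From `(a⁻)³ = 0`, two uses of the C⋆-identity give `(a⁻)² = 0` and then `a⁻ = 0`.
  · rw [h, star_zero, zero_mul, hN.star_eq] at hz
    have hsq : a⁻ * a⁻ = 0 := by
      rw [← CStarRing.star_mul_self_eq_zero_iff, star_mul, hN.star_eq, ← mul_assoc, hz, zero_mul]
    have h0 : a⁻ = 0 := by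
      rw [← CStarRing.star_mul_self_eq_zero_iff, hN.star_eq, hsq]
    exact (CFC.negPart_eq_zero_iff a ha).1 h0

/-- This is `⟪h, Y⋆Y h⟫ = ‖Y h‖²` for columns `h`, in coordinates. Together with
`CStarMatrix.sum_inner_conj` it lets positivity be tested on vectors. -/
theorem CStarMatrix.sum_inner_star_mul_self (Y : CStarMatrix k k (H →L[ℂ] H)) (h : k → H) :
    ∑ i, ∑ j, ⟪h i, (star Y * Y) i j (h j)⟫_ℂ = ((∑ l, ‖∑ j, Y l j (h j)‖ ^ 2 : ℝ) : ℂ) := by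
  have hl : ∀ l, ((‖∑ j, Y l j (h j)‖ ^ 2 : ℝ) : ℂ) =
      ∑ i, ∑ j, ⟪h i, (star (Y l i) * Y l j) (h j)⟫_ℂ := fun l => by
    rw [Complex.ofReal_pow]
    refine (inner_self_eq_norm_sq_to_K (𝕜 := ℂ) (∑ j, Y l j (h j))).symm.trans ?_
    rw [sum_inner]
    refine Finset.sum_congr rfl fun i _ => ?_
    rw [inner_sum]
    refine Finset.sum_congr rfl fun j _ => ?_
    rw [mul_apply_eq_comp, star_eq_adjoint, adjoint_inner_right]
  rw [Complex.ofReal_sum]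
  simp only [hl]
  rw [← Finset.sum_comm_cycle]
  refine Finset.sum_congr rfl fun i _ => Finset.sum_congr rfl fun j _ => ?_
  rw [CStarMatrix.mul_apply, sum_apply, inner_sum]
  rfl

theorem CStarMatrix.sum_inner_conj (M N : CStarMatrix k k (H →L[ℂ] H)) (h : k → H) :
    ∑ i, ∑ j, ⟪h i, (star N * M * N) i j (h j)⟫_ℂ =
      ∑ i, ∑ j, ⟪∑ a, N i a (h a), M i j (∑ b, N j b (h b))⟫_ℂ := by
  have hl : ∀ i j, ⟪∑ a, N i a (h a), M i j (∑ b, N j b (h b))⟫_ℂ =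
      ∑ a, ∑ b, ⟪h a, (star (N i a) * M i j * N j b) (h b)⟫_ℂ := fun i j => by
    rw [sum_inner]
    refine Finset.sum_congr rfl fun a _ => ?_
    rw [map_sum, inner_sum]
    refine Finset.sum_congr rfl fun b _ => ?_
    rw [mul_apply_eq_comp, mul_apply_eq_comp, star_eq_adjoint, adjoint_inner_right]
  have hr : ∀ a b, ⟪h a, (star N * M * N) a b (h b)⟫_ℂ =
      ∑ i, ∑ j, ⟪h a, (star (N i a) * M i j * N j b) (h b)⟫_ℂ := fun a b => by
    rw [CStarMatrix.mul_apply, sum_apply, inner_sum, Finset.sum_comm]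
    refine Finset.sum_congr rfl fun j _ => ?_
    rw [CStarMatrix.mul_apply, Finset.sum_mul, sum_apply, inner_sum]
    rfl
  simp only [hl, hr]
  exact (Finset.sum_congr rfl fun a _ => Finset.sum_comm_cycle.symm).trans
    Finset.sum_comm_cycle.symm

/-- A selfadjoint operator matrix with nonnegative quadratic form is nonnegative. -/
theorem CStarMatrix.nonneg_of_forall_sum_inner_nonneg {M : CStarMatrix k k (H →L[ℂ] H)}
    (hM : IsSelfAdjoint M) (h : ∀ h : k → H, 0 ≤ ∑ i, ∑ j, ⟪h i, M i j (h j)⟫_ℂ) : 0 ≤ M := by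
  classical
  obtain ⟨N, Z, hZ, hM0⟩ := hM.exists_star_conj_eq_neg
  refine hM0 ?_
  ext l j x
  -- At `N` applied to the column with sole entry `x` in place `j`, the form is `-∑ ‖Z l j x‖²`, so
  -- every term vanishes.
  have h1 := h fun i => ∑ a, N i a ((Pi.single j x : k → H) a)
  rw [← CStarMatrix.sum_inner_conj, hZ] at h1
  have hneg : ∀ i j (v w : H), ⟪v, (-(star Z * Z)) i j w⟫_ℂ = -⟪v, (star Z * Z) i j w⟫_ℂ :=
    fun i j v w => inner_neg_right _ _
  simp only [hneg, Finset.sum_neg_distrib] at h1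
  rw [CStarMatrix.sum_inner_star_mul_self, ← Complex.ofReal_neg, Complex.zero_le_real,
    neg_nonneg] at h1
  have h2 := (Finset.sum_eq_zero_iff_of_nonneg fun l _ => sq_nonneg _).1
    (le_antisymm h1 (Finset.sum_nonneg fun l _ => sq_nonneg _)) l (Finset.mem_univ l)
  rw [sq_eq_zero_iff, norm_eq_zero, Finset.sum_eq_single j
    (fun b _ hb => by rw [Pi.single_eq_of_ne hb, map_zero]) (by simp), Pi.single_eq_same] at h2
  exact h2

/-- Compression along an operator between Hilbert spaces preserves positive operator matrices. -/
theorem CStarMatrix.map_compression_nonneg (C : H →L[ℂ] K)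
    {M : CStarMatrix k k (K →L[ℂ] K)} (hM : 0 ≤ M) :
    0 ≤ M.map fun X => (adjoint C) ∘L X ∘L C := by
  classical
  obtain ⟨Y, rfl⟩ := exists_eq_star_mul_self_of_nonneg hM
  refine CStarMatrix.nonneg_of_forall_sum_inner_nonneg ?_ fun h => ?_
  · rw [isSelfAdjoint_iff]
    ext i j : 2
    have hij : adjoint ((star Y * Y) j i) = (star Y * Y) i j :=
      CStarMatrix.star_apply_of_isSelfAdjoint (.star_mul_self Y)
    rw [CStarMatrix.star_apply, CStarMatrix.map_apply, CStarMatrix.map_apply, star_eq_adjoint,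
      adjoint_comp, adjoint_comp, adjoint_adjoint, hij, comp_assoc]
  -- The form of the compression at `h` is the form of `Y⋆Y` at `C h`.
  · have h1 := CStarMatrix.sum_inner_star_mul_self Y fun i => C (h i)
    have h2 : ∀ i j, ⟪h i, ((star Y * Y).map fun X => (adjoint C) ∘L X ∘L C) i j (h j)⟫_ℂ =
        ⟪C (h i), (star Y * Y) i j (C (h j))⟫_ℂ := fun i j => by
      rw [CStarMatrix.map_apply, comp_apply, comp_apply, adjoint_inner_right]
    simp only [h2]
    rw [h1, Complex.zero_le_real]
    exact Finset.sum_nonneg fun l _ => sq_nonneg _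

/-- The completely positive map `x ↦ C⋆ π(x) C`. -/
noncomputable def CompletelyPositiveMap.compression {B : Type*} [CStarAlgebra B] [PartialOrder B]
    [StarOrderedRing B] (π : B →⋆ₐ[ℂ] (K →L[ℂ] K)) (C : H →L[ℂ] K) : B →CP (H →L[ℂ] H) where
  toFun x := (adjoint C) ∘L π x ∘L C
  map_add' x y := by rw [map_add, add_comp, comp_add]
  map_smul' c x := by rw [map_smul, smul_comp, comp_smul, RingHom.id_apply]
  map_cstarMatrix_nonneg' k M hM :=
    CStarMatrix.map_compression_nonneg C
      (CompletelyPositiveMapClass.map_cstarMatrix_nonneg' π k M hM)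

theorem CompletelyPositiveMap.compression_apply {B : Type*} [CStarAlgebra B] [PartialOrder B]
    [StarOrderedRing B] (π : B →⋆ₐ[ℂ] (K →L[ℂ] K)) (C : H →L[ℂ] K) (x : B) :
    CompletelyPositiveMap.compression π C x = (adjoint C) ∘L π x ∘L C := rfl

end CompletelyPositive

theorem nonneg_of_forall_pos_add_smul_nonneg {B : Type*} [NonUnitalCStarAlgebra B]
    [PartialOrder B] [StarOrderedRing B] {a b : B}
    (h : ∀ ε : ℝ, 0 < ε → 0 ≤ a + (ε : ℂ) • b) : 0 ≤ a := by
  have hc : Continuous fun ε : ℝ => a + (ε : ℂ) • b := by fun_prop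
  have ht : Filter.Tendsto (fun ε : ℝ => a + (ε : ℂ) • b) (nhdsWithin 0 (Set.Ioi 0)) (nhds a) := by
    simpa using (hc.tendsto 0).mono_left nhdsWithin_le_nhds
  exact CStarAlgebra.isClosed_nonneg.mem_of_tendsto ht
    (Filter.eventually_of_mem self_mem_nhdsWithin h)

/-! ### Words in a Cuntz family and density of their span -/

theorem wordProd_one {ι M : Type*} [Monoid M] (T : ι → M) : wordProd T 1 = 1 :=
  map_one (FreeMonoid.lift T)

theorem wordProd_mul {ι M : Type*} [Monoid M] (T : ι → M) (α β : FreeMonoid ι) :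
    wordProd T (α * β) = wordProd T α * wordProd T β :=
  map_mul (FreeMonoid.lift T) α β

theorem wordProd_of {ι M : Type*} [Monoid M] (T : ι → M) (i : ι) :
    wordProd T (FreeMonoid.of i) = T i :=
  FreeMonoid.lift_eval_of T i

theorem map_wordProd {ι M N F : Type*} [Monoid M] [Monoid N] [FunLike F M N] [MonoidHomClass F M N]
    (f : F) (T : ι → M) (α : FreeMonoid ι) : f (wordProd T α) = wordProd (fun i => f (T i)) α := by
  induction α using FreeMonoid.inductionOn' with
  | one => rw [wordProd_one, wordProd_one, map_one]
  | of_mul i α ih => rw [wordProd_mul, wordProd_mul, map_mul, ih, wordProd_of, wordProd_of]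

namespace IsCuntzFamily

variable {ι : Type} {B : Type*} [CStarAlgebra B] {v : ι → B}

/-- Equal leading letters cancel and unequal ones give 0; otherwise the rest of the longer word
survives. This makes the span of the `v_α v_β⋆` closed under products. -/
theorem star_wordProd_mul_wordProd (hv : IsCuntzFamily v) (α β : FreeMonoid ι) :
    star (wordProd v α) * wordProd v β = 0 ∨
      (∃ γ, star (wordProd v α) * wordProd v β = wordProd v γ) ∨
      ∃ γ, star (wordProd v α) * wordProd v β = star (wordProd v γ) := by
  induction α using FreeMonoid.inductionOn' generalizing β with
  | one => exact .inr (.inl ⟨β, by rw [wordProd_one, star_one, one_mul]⟩)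
  | of_mul i α ih =>
    cases β using FreeMonoid.casesOn with
    | one => exact .inr (.inr ⟨.of i * α, by rw [wordProd_one, mul_one]⟩)
    | of_mul j β =>
      have h : star (wordProd v (.of i * α)) * wordProd v (.of j * β) =
          star (wordProd v α) * (star (v i) * v j) * wordProd v β := by
        simp only [wordProd_mul, wordProd_of, star_mul, mul_assoc]
      rw [h]
      by_cases hij : i = j
      · subst hij
        rw [hv.star_mul_self, mul_one]
        exact ih β
      · rw [hv.star_mul_of_ne i j hij, mul_zero, zero_mul]
        exact .inl rfl

/-- The ⋆-algebra generated by a Cuntz family is spanned by the `v_α v_β⋆`. -/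
theorem mem_span_of_mem_adjoin (hv : IsCuntzFamily v) {x : B}
    (hx : x ∈ StarAlgebra.adjoin ℂ (Set.range v)) :
    x ∈ Submodule.span ℂ
      (Set.range fun p : FreeMonoid ι × FreeMonoid ι => wordProd v p.1 * star (wordProd v p.2)) := by
  set S : Set B :=
    Set.range fun p : FreeMonoid ι × FreeMonoid ι => wordProd v p.1 * star (wordProd v p.2)
  have hmem : ∀ α β, wordProd v α * star (wordProd v β) ∈ Submodule.span ℂ S := fun α β =>
    Submodule.subset_span ⟨(α, β), rfl⟩
  induction hx using StarAlgebra.adjoin_induction with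
  | mem x hx =>
    obtain ⟨i, rfl⟩ := hx
    simpa only [wordProd_one, wordProd_of, star_one, mul_one] using hmem (.of i) 1
  | algebraMap r =>
    rw [Algebra.algebraMap_eq_smul_one]
    refine Submodule.smul_mem _ _ ?_
    simpa only [wordProd_one, star_one, mul_one] using hmem 1 1
  | add x y _ _ hx hy => exact add_mem hx hy
  | star x _ hx =>
    refine Submodule.span_induction (p := fun y _ => star y ∈ Submodule.span ℂ S) ?_ ?_ ?_ ?_ hx
    · rintro _ ⟨⟨α, β⟩, rfl⟩
      simpa only [star_mul, star_star] using hmem β α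
    · rw [star_zero]
      exact zero_mem _
    · intro x y _ _ hx hy
      rw [star_add]
      exact add_mem hx hy
    · intro c x _ hx
      rw [star_smul]
      exact Submodule.smul_mem _ _ hx
  | mul x y _ _ hx hy =>
    have hxy := Submodule.mul_mem_mul hx hy
    rw [Submodule.span_mul_span] at hxy
    refine Submodule.span_le.2 ?_ hxy
    rintro _ ⟨_, ⟨⟨α, β⟩, rfl⟩, _, ⟨⟨γ, δ⟩, rfl⟩, rfl⟩
    have h : wordProd v α * star (wordProd v β) * (wordProd v γ * star (wordProd v δ)) =
        wordProd v α * (star (wordProd v β) * wordProd v γ) * star (wordProd v δ) := by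
      simp only [mul_assoc]
    dsimp only
    rw [h, SetLike.mem_coe]
    rcases hv.star_wordProd_mul_wordProd β γ with h0 | ⟨ε, h0⟩ | ⟨ε, h0⟩
    · rw [h0, mul_zero, zero_mul]
      exact zero_mem _
    · rw [h0, ← wordProd_mul]
      exact hmem _ _
    · rw [h0, mul_assoc, ← star_mul, ← wordProd_mul]
      exact hmem _ _

end IsCuntzFamily

/-- Continuous linear maps on the Cuntz algebra are determined by their values on the
`v_α v_β⋆`. -/
theorem CuntzAlgebra.eq_of_wordProd {ι : Type} {E : Type*} [NormedAddCommGroup E] [NormedSpace ℂ E]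
    {f g : CuntzAlgebra.{u} ι → E} (hf : IsLinearMap ℂ f) (hg : IsLinearMap ℂ g)
    (hfc : Continuous f) (hgc : Continuous g)
    (h : ∀ α β : FreeMonoid ι, f (wordProd CuntzAlgebra.v α * star (wordProd CuntzAlgebra.v β)) =
      g (wordProd CuntzAlgebra.v α * star (wordProd CuntzAlgebra.v β))) : f = g := by
  refine Continuous.ext_on 
    (s := ↑(StarAlgebra.adjoin ℂ (Set.range (CuntzAlgebra.v.{u} (ι := ι))))) ?_ hfc hgc
    fun x hx => ?_
  · rw [dense_iff_closure_eq, ← StarSubalgebra.topologicalClosure_coe,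
      CuntzAlgebra.topologicalClosure_adjoin_v]
    rfl
  · refine LinearMap.eqOn_span (f := hf.mk') (g := hg.mk') ?_
      ((CuntzAlgebra.isCuntzFamily_v ι).mem_span_of_mem_adjoin hx)
    rintro _ ⟨⟨α, β⟩, rfl⟩
    exact h α β

/-- Sequences supported at index 0 give the vector functionals. Weak convergence is all that the
construction needs. -/
theorem HasUltraweakSum.hasSum_inner {ι H : Type*} [NormedAddCommGroup H] [InnerProductSpace ℂ H]
    {f : ι → H →L[ℂ] H} {s : H →L[ℂ] H} (h : HasUltraweakSum f s) (x y : H) :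
    HasSum (fun i => ⟪y, f i x⟫_ℂ) ⟪y, s x⟫_ℂ := by
  have hs : ∀ T : H →L[ℂ] H, ∑' k, ⟪lp.single (E := fun _ : ℕ => H) 2 0 y k,
      T (lp.single (E := fun _ : ℕ => H) 2 0 x k)⟫_ℂ = ⟪y, T x⟫_ℂ := fun T => by
    rw [tsum_eq_single 0, lp.single_apply_self, lp.single_apply_self]
    intro k hk
    rw [lp.single_apply_ne _ _ _ hk, inner_zero_left]
  simpa only [hs] using h (lp.single 2 0 x) (lp.single 2 0 y)

/-! ### Construction of the completely positive maps -/

section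

variable {ι : Type} {H : Type u} [NormedAddCommGroup H] [InnerProductSpace ℂ H] [CompleteSpace H]

/-- A map intertwining `V⋆` with `A⋆` gives a completely positive map. -/
theorem exists_completelyPositiveMap_of_intertwining {K : Type u} [NormedAddCommGroup K]
    [InnerProductSpace ℂ K] [CompleteSpace K] (A : ι → H →L[ℂ] H) {V : ι → K →L[ℂ] K}
    (hV : IsCuntzFamily V) (C : H →L[ℂ] K) (hC : ∀ i h, star (V i) (C h) = C (star (A i) h)) :
    ∃ Φ : CuntzAlgebra.{u} ι →CP (H →L[ℂ] H), ∀ α β : FreeMonoid ι,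
      Φ (wordProd CuntzAlgebra.v α * star (wordProd CuntzAlgebra.v β)) =
        wordProd A α * ((ContinuousLinearMap.adjoint C) ∘L C) * star (wordProd A β) := by
  obtain ⟨π, hπ, -⟩ := CuntzAlgebra.existsUnique_lift V hV
  have hw : ∀ (α : FreeMonoid ι) h, star (wordProd V α) (C h) = C (star (wordProd A α) h) := by
    intro α
    induction α using FreeMonoid.inductionOn' with
    | one => intro h; simp [wordProd_one]
    | of_mul i α ih =>
      intro h
      simp only [wordProd_mul, wordProd_of, star_mul, mul_apply_eq_comp, hC, ih]
  refine ⟨.compression π C, fun α β => ?_⟩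
  have hv : ∀ α, π (wordProd CuntzAlgebra.v α) = wordProd V α := fun α => by
    rw [map_wordProd]
    simp only [hπ]
  ext h
  refine ext_inner_left ℂ fun g => ?_
  rw [CompletelyPositiveMap.compression_apply, map_mul, map_star, hv, hv]
  simp only [ContinuousLinearMap.comp_apply, mul_apply_eq_comp, hw,
    ContinuousLinearMap.adjoint_inner_right]
  -- The intertwining concerns adjoints only, so `V_α` is moved to the left entry of the inner
  -- product and `A_α` back.
  rw [← ContinuousLinearMap.adjoint_inner_left, ← ContinuousLinearMap.star_eq_adjoint, hw,
    ContinuousLinearMap.star_eq_adjoint (wordProd A α),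
    ← ContinuousLinearMap.adjoint_inner_right C, ContinuousLinearMap.adjoint_inner_left]

theorem exists_completelyPositiveMap_of_isUnit [Countable ι] [Nonempty ι]
    [TopologicalSpace.SeparableSpace H] (A : ι → H →L[ℂ] H) {D : H →L[ℂ] H} (hD : 0 ≤ D)
    (hDu : IsUnit D)
    (hA : ∀ x y, HasSum (fun i => ⟪y, (A i * D * star (A i)) x⟫_ℂ) ⟪y, D x⟫_ℂ) :
    ∃ Φ : CuntzAlgebra.{u} ι →CP (H →L[ℂ] H), ∀ α β : FreeMonoid ι,
      Φ (wordProd CuntzAlgebra.v α * star (wordProd CuntzAlgebra.v β)) =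
        wordProd A α * D * star (wordProd A β) := by
  obtain ⟨S, hS, hSD⟩ : ∃ S : H →L[ℂ] H, star S = S ∧ S * S = D :=
    ⟨CFC.sqrt D, (CFC.sqrt_nonneg D).isSelfAdjoint, CFC.sqrt_mul_sqrt_self D hD⟩
  have hSu : IsUnit S := by
    rw [← hSD, (Commute.refl S).isUnit_mul_iff] at hDu
    exact hDu.1
  obtain ⟨T, hST, hTS⟩ := isUnit_iff_exists.1 hSu
  have hT : star T = T := by
    rw [← mul_one (star T), ← hST, ← mul_assoc, ← hS, ← star_mul, hST, star_one, one_mul]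
  have hSi : ∀ x y, ⟪S x, y⟫_ℂ = ⟪x, S y⟫_ℂ := fun x y => by
    rw [← ContinuousLinearMap.adjoint_inner_right, ← ContinuousLinearMap.star_eq_adjoint, hS]
  have hnorm : ∀ g, ((‖S g‖ ^ 2 : ℝ) : ℂ) = ⟪g, D g⟫_ℂ := fun g => by
    rw [Complex.ofReal_pow]
    refine (inner_self_eq_norm_sq_to_K (𝕜 := ℂ) (S g)).symm.trans ?_
    rw [hSi, ← hSD, mul_apply_eq_comp]
  have hST' : ∀ h, S (T h) = h := fun h => DFunLike.congr_fun hST h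
  have hTS' : ∀ h, T (S h) = h := fun h => DFunLike.congr_fun hTS h
  have hB : ∀ i h, star (T * A i * S) h = S (star (A i) (T h)) := fun i h => by
    rw [star_mul, star_mul, hS, hT]
    rfl
  -- With `S = D^{1/2}` and `T = S⁻¹`, the sum is `∑ ⟪T h, Aᵢ D Aᵢ⋆ T h⟫ = ⟪T h, D T h⟫ = ‖h‖²`.
  obtain ⟨K, _, _, _, J, V, hV, hJ⟩ := exists_isCuntzFamily_dilation (fun i => T * A i * S)
    (fun h => by
      rw [← Complex.hasSum_ofReal]
      convert! hA (T h) (T h) using 2 with i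
      · rw [hB, hnorm, mul_apply_eq_comp, mul_apply_eq_comp,
          ContinuousLinearMap.star_eq_adjoint, ContinuousLinearMap.adjoint_inner_left]
      · rw [← hnorm, hST'])
  -- `Vᵢ⋆ J S = J (S Aᵢ⋆ T) S = J S Aᵢ⋆`.
  have hC := exists_completelyPositiveMap_of_intertwining A hV (J.toContinuousLinearMap ∘L S)
    (fun i h => (hJ i (S h)).trans (by rw [hB, hTS']; rfl))
  have hCD : (ContinuousLinearMap.adjoint (J.toContinuousLinearMap ∘L S)) ∘L
      (J.toContinuousLinearMap ∘L S) = D := by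
    ext h
    refine ext_inner_left ℂ fun g => ?_
    rw [ContinuousLinearMap.comp_apply, ContinuousLinearMap.adjoint_inner_right, ← hSD,
      mul_apply_eq_comp, ← hSi]
    exact J.inner_map_map _ _
  rwa [hCD] at hC

theorem existsUnique_completelyPositiveMap_of_exists {A : ι → H →L[ℂ] H} {D : H →L[ℂ] H}
    (h : ∃ Φ : CuntzAlgebra.{u} ι →CP (H →L[ℂ] H), ∀ α β : FreeMonoid ι,
      Φ (wordProd CuntzAlgebra.v α * star (wordProd CuntzAlgebra.v β)) =
        wordProd A α * D * star (wordProd A β)) :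
    ∃! Φ : CuntzAlgebra.{u} ι →CP (H →L[ℂ] H),
      Φ 1 = D ∧ ∀ α β : FreeMonoid ι,
        Φ (wordProd CuntzAlgebra.v α * star (wordProd CuntzAlgebra.v β)) =
          wordProd A α * D * star (wordProd A β) := by
  obtain ⟨Φ, hΦ⟩ := h
  refine ⟨Φ, ⟨?_, hΦ⟩, fun Ψ hΨ => ?_⟩
  · simpa only [wordProd_one, star_one, mul_one, one_mul] using hΦ 1 1
  · exact DFunLike.coe_injective (CuntzAlgebra.eq_of_wordProd ⟨map_add Ψ, map_smul Ψ⟩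
      ⟨map_add Φ, map_smul Φ⟩ (map_continuous Ψ) (map_continuous Φ)
      fun α β => (hΨ.2 α β).trans (hΦ α β).symm)

/-- If all `D + ε` and `1` are values at `1` of completely positive maps of the required form,
then so is `D`. -/
theorem exists_completelyPositiveMap_of_forall_pos {A : ι → H →L[ℂ] H} {D : H →L[ℂ] H}
    (Ψ : CuntzAlgebra.{u} ι →CP (H →L[ℂ] H))
    (hΨ : ∀ α β : FreeMonoid ι,
      Ψ (wordProd CuntzAlgebra.v α * star (wordProd CuntzAlgebra.v β)) =
        wordProd A α * 1 * star (wordProd A β))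
    (h : ∀ ε : ℝ, 0 < ε → ∃ Φ : CuntzAlgebra.{u} ι →CP (H →L[ℂ] H), ∀ α β : FreeMonoid ι,
      Φ (wordProd CuntzAlgebra.v α * star (wordProd CuntzAlgebra.v β)) =
        wordProd A α * (D + (ε : ℂ) • 1) * star (wordProd A β)) :
    ∃ Φ : CuntzAlgebra.{u} ι →CP (H →L[ℂ] H), ∀ α β : FreeMonoid ι,
      Φ (wordProd CuntzAlgebra.v α * star (wordProd CuntzAlgebra.v β)) =
        wordProd A α * D * star (wordProd A β) := by
  -- This supplies the default value that `choose!` needs for `ε ≤ 0`.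
  have : Nonempty (CuntzAlgebra.{u} ι →CP (H →L[ℂ] H)) := ⟨Ψ⟩
  choose! Φ hΦ using h
  -- `Φ 1` is the map for `ε = 1`; subtracting `Ψ` replaces `D + 1` by `D`.
  let L : CuntzAlgebra.{u} ι →ₗ[ℂ] (H →L[ℂ] H) :=
    { toFun := fun x => Φ 1 x - Ψ x
      map_add' := fun x y => by rw [map_add, map_add, add_sub_add_comm]
      map_smul' := fun c x => by rw [map_smul, map_smul, smul_sub, RingHom.id_apply] }
  have hLc : Continuous L := (map_continuous (Φ 1)).sub (map_continuous Ψ)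
  have hL : ∀ α β : FreeMonoid ι,
      L (wordProd CuntzAlgebra.v α * star (wordProd CuntzAlgebra.v β)) =
        wordProd A α * D * star (wordProd A β) := fun α β => by
    change Φ 1 _ - Ψ _ = _
    rw [hΦ 1 one_pos, hΨ, Complex.ofReal_one, one_smul, mul_add, add_mul, add_sub_cancel_right]
  have hLΦ : ∀ ε : ℝ, 0 < ε → ∀ x, Φ ε x = L x + (ε : ℂ) • Ψ x := fun ε hε =>
    congrFun (CuntzAlgebra.eq_of_wordProd ⟨map_add (Φ ε), map_smul (Φ ε)⟩
      (L + (ε : ℂ) • (Ψ : CuntzAlgebra.{u} ι →ₗ[ℂ] (H →L[ℂ] H))).isLinear (map_continuous (Φ ε))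
      (hLc.add ((map_continuous Ψ).const_smul (ε : ℂ))) fun α β => by
        rw [hΦ ε hε, hL, mul_add, add_mul, mul_smul_comm, smul_mul_assoc,
          ← hΨ])
  refine ⟨{ toLinearMap := L, map_cstarMatrix_nonneg' := fun k M hM => ?_ }, hL⟩
  -- At each matrix level, `Φ ε = L + ε Ψ` is positive for every `ε > 0`, and the positive cone is
  -- closed.
  refine nonneg_of_forall_pos_add_smul_nonneg (b := M.map Ψ) fun ε hε => ?_
  convert! (Φ ε).map_cstarMatrix_nonneg' k M hM using 1
  exact CStarMatrix.ext fun i j => (hLΦ ε hε (M i j)).symm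

end

theorem theorem2p3 {ι : Type} [Countable ι] [Nontrivial ι]
    {H : Type u} [NormedAddCommGroup H] [InnerProductSpace ℂ H] [CompleteSpace H]
    [TopologicalSpace.SeparableSpace H]
    (A : ι → H →L[ℂ] H) (φ : (H →L[ℂ] H) → (H →L[ℂ] H))
    (hφ : ∀ X : H →L[ℂ] H, HasUltraweakSum (fun i => A i * X * star (A i)) (φ X)) :
    (∀ D : H →L[ℂ] H, 0 ≤ D → IsUnit D → φ D = D →
      ∃! Φ : CuntzAlgebra.{u} ι →CP (H →L[ℂ] H),
        Φ 1 = D ∧ ∀ α β : FreeMonoid ι,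
          Φ (wordProd CuntzAlgebra.v α * star (wordProd CuntzAlgebra.v β)) =
            wordProd A α * D * star (wordProd A β)) ∧
    (φ 1 = 1 → ∀ D : H →L[ℂ] H, 0 ≤ D → φ D = D →
      ∃! Φ : CuntzAlgebra.{u} ι →CP (H →L[ℂ] H),
        Φ 1 = D ∧ ∀ α β : FreeMonoid ι,
          Φ (wordProd CuntzAlgebra.v α * star (wordProd CuntzAlgebra.v β)) =
            wordProd A α * D * star (wordProd A β)) := by
  have hsum : ∀ D, φ D = D → ∀ x y,
      HasSum (fun i => ⟪y, (A i * D * star (A i)) x⟫_ℂ) ⟪y, D x⟫_ℂ := fun D hD x y => by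
    simpa only [hD] using (hφ D).hasSum_inner x y
  refine ⟨fun D hD hDu hDφ => existsUnique_completelyPositiveMap_of_exists
    (exists_completelyPositiveMap_of_isUnit A hD hDu (hsum D hDφ)), fun h1 D hD hDφ =>
    existsUnique_completelyPositiveMap_of_exists ?_⟩
  obtain ⟨Ψ, hΨ⟩ := exists_completelyPositiveMap_of_isUnit A zero_le_one isUnit_one (hsum 1 h1)
  refine exists_completelyPositiveMap_of_forall_pos Ψ hΨ fun ε hε => ?_
  have hε1 : (0 : H →L[ℂ] H) ≤ (ε : ℂ) • 1 :=
    smul_nonneg (Complex.zero_le_real.2 hε.le) zero_le_one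
  -- `D + ε` is invertible because it dominates `ε`, and its sum identity combines those for `D` and
  -- for `1`.
  refine exists_completelyPositiveMap_of_isUnit A (add_nonneg hD hε1) ?_ fun x y => ?_
  · have hu : IsStrictlyPositive ((ε : ℂ) • (1 : H →L[ℂ] H)) := by
      refine ⟨hε1, ?_⟩
      exact (isUnit_one (M := H →L[ℂ] H)).smul (Units.mk0 (ε : ℂ) (by exact_mod_cast hε.ne'))
    exact CStarAlgebra.isUnit_of_le _ (le_add_of_nonneg_left hD) hu
  · have h := (hsum D hDφ x y).add ((hsum 1 h1 x y).mul_left (ε : ℂ))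
    simpa only [mul_add, add_mul, mul_smul_comm, smul_mul_assoc, add_apply,
      smul_apply, inner_add_right, inner_smul_right] using h
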